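/- Work in the propositional language $\{\wedge,\vee,\cdot,\to,0,1\}$ with countably many variables, and put $\neg\varphi:=\varphi\to 0$. A *logic* is a substitution-invariant consequence relation on formulas, and $\mathbf L\subseteq\mathbf K$ means inclusion of consequence relations. $\mathbf{FL_e}$ is the external logic of the Full Lambek sequent calculus with exchange ($\Phi\vdash\psi$ iff the sequent ${}\Rightarrow\psi$ is derivable in the calculus, with cut, from the sequents ${}\Rightarrow\varphi$, $\varphi\in\Phi$). $\mathbf{IPL}$ and $\mathbf{CPL}$ are intuitionistic and classical propositional logic in this language ($\cdot$ behaves as $\wedge$, $0$ as falsum, $1$ as verum). A logic is an *axiomatic extension* of $\mathbf K$ if it arises from $\mathbf K$ by adding a substitution-closed set of axioms; a *substructural logic* is an axiomatic extension of $\mathbf{FL_e}$. An *$\mathsf{FL_e}$-algebra* is a lattice-ordered commutative monoid $(A,\wedge,\vee,\cdot,1)$ with a constant $0$ and an operation $\to$ such that $xy\le z\iff x\le y\to z$; $\mathsf V(\mathbf L)$ is the class of $\mathsf{FL_e}$-algebras satisfying $1\le\varphi$ for all theorems $\varphi$ of $\mathbf L$. $\mathbf G_{\mathbf{FL_e}}(\mathbf{CPL})$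 denotes the least substructural logic $\mathbf K$ such that, for every formula $\varphi$, $\vdash_{\mathbf{CPL}}\varphi$ iff $\vdash_{\mathbf K}\neg\neg\varphi$. For a binary connective $\Rightarrow$ defined by a term, $(\mathbf L,\Rightarrow)$ is *proto-connexive* if every $\mathbf A\in\mathsf V(\mathbf L)$ satisfies, for all $x,y\in A$, $$1\le\neg(x\Rightarrow\neg x),\qquad 1\le\neg(\neg x\Rightarrow x),$$ $$1\le(x\Rightarrow y)\Rightarrow\neg(x\Rightarrow\neg y),\qquad 1\le(x\Rightarrow\neg y)\Rightarrow\neg(x\Rightarrow y),$$ and *connexive* if, moreover, some $\mathbf A\in\mathsf V(\mathbf L)$ has elements $x,y$ with $x\Rightarrow y\ne y\Rightarrow x$. Let $$x\Rightarrow_\wedge y:=(x\to y)\wedge(y\to\neg\neg x),\qquad x\Rightarrow_\circ y:=(x\to y)\cdot(y\to\neg\neg x).$$ **Theorem.** Let $\mathbf L$ be a substructural logic with $\mathbf{FL_e}\subseteq\mathbf L\subseteq\mathbf{IPL}$. Then the following are equivalent: 1. $(\mathbf L,\Rightarrow_\wedge)$ is connexive. 2. $(\mathbf L,\Rightarrow_\wedge)$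 is proto-connexive. 3. Any one of Boethius' theses for $\Rightarrow_\wedge$ is a theorem of $\mathbf L$; that is, each of the following two conditions is equivalent to the others: (3a) $\vdash_{\mathbf L}(\varphi\Rightarrow_\wedge\psi)\Rightarrow_\wedge\neg(\varphi\Rightarrow_\wedge\neg\psi)$ for all formulas $\varphi,\psi$; (3b) $\vdash_{\mathbf L}(\varphi\Rightarrow_\wedge\neg\psi)\Rightarrow_\wedge\neg(\varphi\Rightarrow_\wedge\psi)$ for all formulas $\varphi,\psi$. 4. $\mathbf G_{\mathbf{FL_e}}(\mathbf{CPL})$ exists and $\mathbf L$ is an axiomatic extension of it. If, in addition, $\vdash_{\mathbf L}\varphi\to\neg\neg1$ for every formula $\varphi$, then the same equivalences hold with $\Rightarrow_\circ$ in place of $\Rightarrow_\wedge$. -/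

import Mathlib

universe u

namespace Connexive

/-! ## Formulas -/

/-- Formulas over the language `{∧, ∨, ·, →, 0, 1}` with countably many variables. They are also
the terms in the language of `FLe`-algebras. -/
inductive Fm : Type
  | var (n : ℕ)
  | and (φ ψ : Fm)
  | or (φ ψ : Fm)
  | fus (φ ψ : Fm)
  | imp (φ ψ : Fm)
  | zero
  | one

namespace Fm

/-- Negation `¬φ := φ → 0`. -/
def neg (φ : Fm) : Fm := φ.imp zero

/-- Simultaneous substitution of formulas for variables. -/
def subst (σ : ℕ → Fm) : Fm → Fm
  | var n => σ n
  | and φ ψ => and (φ.subst σ) (ψ.subst σ)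
  | or φ ψ => or (φ.subst σ) (ψ.subst σ)
  | fus φ ψ => fus (φ.subst σ) (ψ.subst σ)
  | imp φ ψ => imp (φ.subst σ) (ψ.subst σ)
  | zero => zero
  | one => one

/-- The value of a formula under a two-valued (truth-table) valuation: `·` is read as
conjunction, `0` as falsum and `1` as verum. -/
def truth (v : ℕ → Bool) : Fm → Bool
  | var n => v n
  | and φ ψ => φ.truth v && ψ.truth v
  | or φ ψ => φ.truth v || ψ.truth v
  | fus φ ψ => φ.truth v && ψ.truth v
  | imp φ ψ => !(φ.truth v) || ψ.truth v
  | zero => false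
  | one => true

/-- The binary connective defined by a formula `t` in the variables `p₀, p₁`. -/
def conn (t φ ψ : Fm) : Fm := t.subst fun n => if n = 0 then φ else ψ

end Fm

/-! ## Logics -/

/-- A logic: a structural (substitution-invariant) consequence relation between sets of formulas
and formulas. -/
@[ext]
structure Logic where
  /-- The consequence relation. -/
  Entails : Set Fm → Fm → Prop
  refl : ∀ (Γ : Set Fm) (φ : Fm), φ ∈ Γ → Entails Γ φ
  mono : ∀ (Γ Δ : Set Fm) (φ : Fm), Γ ⊆ Δ → Entails Γ φ → Entails Δ φ
  trans : ∀ (Γ Δ : Set Fm) (φ : Fm), (∀ ψ ∈ Δ, Entails Γ ψ) → Entails Δ φ → Entails Γ φ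
  structural : ∀ (σ : ℕ → Fm) (Γ : Set Fm) (φ : Fm),
    Entails Γ φ → Entails (Fm.subst σ '' Γ) (φ.subst σ)

/-- Logics are ordered by inclusion of their consequence relations. -/
instance : PartialOrder Logic where
  le L K := ∀ Γ φ, L.Entails Γ φ → K.Entails Γ φ
  le_refl _ _ _ h := h
  le_trans _ _ _ h₁ h₂ Γ φ h := h₂ Γ φ (h₁ Γ φ h)
  le_antisymm L K h₁ h₂ := by
    ext Γ φ
    exact ⟨h₁ Γ φ, h₂ Γ φ⟩

namespace Logic

/-- `φ` is a theorem of `L`. -/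
def IsTheorem (L : Logic) (φ : Fm) : Prop := L.Entails ∅ φ

/-- `L` is an axiomatic extension of `K`: it arises from `K` by adding a set of axioms that is
closed under substitution. -/
def IsAxiomaticExtensionOf (L K : Logic) : Prop :=
  ∃ A : Set Fm, (∀ σ : ℕ → Fm, ∀ φ ∈ A, φ.subst σ ∈ A) ∧
    ∀ Γ φ, L.Entails Γ φ ↔ K.Entails (Γ ∪ A) φ

end Logic

/-! ## Sequent calculi -/

/-- Sequents `Γ ⇒ P` with `Γ` a finite multiset of formulas (so that the exchange rule is built in)
and `P` empty or a single formula. -/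
abbrev Sequent : Type := Multiset Fm × Option Fm

/-- Derivability of sequents from a set `S` of sequents. With `w = False` the rules are those of
the Full Lambek calculus with exchange; with `w = True` left weakening, right weakening and
contraction are added, which gives Gentzen's calculus `LJ`. -/
inductive Derivable (w : Prop) (S : Set Sequent) : Multiset Fm → Option Fm → Prop
  | hyp {Γ P} : (Γ, P) ∈ S → Derivable w S Γ P
  | id (φ : Fm) : Derivable w S {φ} (some φ)
  | cut {Γ Δ P} (φ : Fm) : Derivable w S Γ (some φ) → Derivable w S (φ ::ₘ Δ) P →
      Derivable w S (Γ + Δ) P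
  | oneL {Γ P} : Derivable w S Γ P → Derivable w S (Fm.one ::ₘ Γ) P
  | oneR : Derivable w S 0 (some Fm.one)
  | zeroL : Derivable w S {Fm.zero} none
  | zeroR {Γ} : Derivable w S Γ none → Derivable w S Γ (some Fm.zero)
  | fusL {Γ P} {φ ψ : Fm} : Derivable w S (φ ::ₘ ψ ::ₘ Γ) P → Derivable w S (φ.fus ψ ::ₘ Γ) P
  | fusR {Γ Δ} {φ ψ : Fm} : Derivable w S Γ (some φ) → Derivable w S Δ (some ψ) →
      Derivable w S (Γ + Δ) (some (φ.fus ψ))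
  | impL {Γ Δ P} {φ ψ : Fm} : Derivable w S Γ (some φ) → Derivable w S (ψ ::ₘ Δ) P →
      Derivable w S (φ.imp ψ ::ₘ (Γ + Δ)) P
  | impR {Γ} {φ ψ : Fm} : Derivable w S (φ ::ₘ Γ) (some ψ) → Derivable w S Γ (some (φ.imp ψ))
  | andL₁ {Γ P} {φ ψ : Fm} : Derivable w S (φ ::ₘ Γ) P → Derivable w S (φ.and ψ ::ₘ Γ) P
  | andL₂ {Γ P} {φ ψ : Fm} : Derivable w S (ψ ::ₘ Γ) P → Derivable w S (φ.and ψ ::ₘ Γ) P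
  | andR {Γ} {φ ψ : Fm} : Derivable w S Γ (some φ) → Derivable w S Γ (some ψ) →
      Derivable w S Γ (some (φ.and ψ))
  | orL {Γ P} {φ ψ : Fm} : Derivable w S (φ ::ₘ Γ) P → Derivable w S (ψ ::ₘ Γ) P →
      Derivable w S (φ.or ψ ::ₘ Γ) P
  | orR₁ {Γ} {φ ψ : Fm} : Derivable w S Γ (some φ) → Derivable w S Γ (some (φ.or ψ))
  | orR₂ {Γ} {φ ψ : Fm} : Derivable w S Γ (some ψ) → Derivable w S Γ (some (φ.or ψ))
  | weakL {Γ P} {φ : Fm} : w → Derivable w S Γ P → Derivable w S (φ ::ₘ Γ) P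
  | weakR {Γ} {φ : Fm} : w → Derivable w S Γ none → Derivable w S Γ (some φ)
  | contr {Γ P} {φ : Fm} : w → Derivable w S (φ ::ₘ φ ::ₘ Γ) P → Derivable w S (φ ::ₘ Γ) P

/-- The sequents `⇒ φ` for `φ ∈ Φ`. -/
def assertions (Φ : Set Fm) : Set Sequent := {s | ∃ φ ∈ Φ, s = (0, some φ)}

theorem Derivable.trans {w : Prop} {S T : Set Sequent}
    (hST : ∀ s ∈ S, Derivable w T s.1 s.2) {Γ : Multiset Fm} {P : Option Fm}
    (h : Derivable w S Γ P) : Derivable w T Γ P := by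
  induction h with
  | hyp h => exact hST _ h
  | id φ => exact .id φ
  | cut φ _ _ h₁ h₂ => exact .cut φ h₁ h₂
  | oneL _ h => exact .oneL h
  | oneR => exact .oneR
  | zeroL => exact .zeroL
  | zeroR _ h => exact .zeroR h
  | fusL _ h => exact .fusL h
  | fusR _ _ h₁ h₂ => exact .fusR h₁ h₂
  | impL _ _ h₁ h₂ => exact .impL h₁ h₂
  | impR _ h => exact .impR h
  | andL₁ _ h => exact .andL₁ h
  | andL₂ _ h => exact .andL₂ h
  | andR _ _ h₁ h₂ => exact .andR h₁ h₂
  | orL _ _ h₁ h₂ => exact .orL h₁ h₂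
  | orR₁ _ h => exact .orR₁ h
  | orR₂ _ h => exact .orR₂ h
  | weakL hw _ h => exact .weakL hw h
  | weakR hw _ h => exact .weakR hw h
  | contr hw _ h => exact .contr hw h

theorem Derivable.subst {w : Prop} {S T : Set Sequent} (σ : ℕ → Fm)
    (hST : ∀ s ∈ S, (s.1.map (Fm.subst σ), s.2.map (Fm.subst σ)) ∈ T)
    {Γ : Multiset Fm} {P : Option Fm} (h : Derivable w S Γ P) :
    Derivable w T (Γ.map (Fm.subst σ)) (P.map (Fm.subst σ)) := by
  induction h with
  | hyp h => exact .hyp (hST _ h)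
  | id φ => simpa using Derivable.id (φ.subst σ)
  | cut φ _ _ h₁ h₂ =>
    simp only [Multiset.map_add, Multiset.map_cons] at *
    exact .cut (φ.subst σ) h₁ h₂
  | oneL _ h => simpa [Fm.subst] using Derivable.oneL h
  | oneR => exact .oneR
  | zeroL => exact .zeroL
  | zeroR _ h => exact .zeroR h
  | fusL _ h =>
    simp only [Multiset.map_cons] at *
    exact .fusL h
  | fusR _ _ h₁ h₂ =>
    simp only [Multiset.map_add] at *
    exact .fusR h₁ h₂
  | impL _ _ h₁ h₂ =>
    simp only [Multiset.map_add, Multiset.map_cons] at *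
    exact .impL h₁ h₂
  | impR _ h =>
    simp only [Multiset.map_cons] at *
    exact .impR h
  | andL₁ _ h =>
    simp only [Multiset.map_cons] at *
    exact .andL₁ h
  | andL₂ _ h =>
    simp only [Multiset.map_cons] at *
    exact .andL₂ h
  | andR _ _ h₁ h₂ => exact .andR h₁ h₂
  | orL _ _ h₁ h₂ =>
    simp only [Multiset.map_cons] at *
    exact .orL h₁ h₂
  | orR₁ _ h => exact .orR₁ h
  | orR₂ _ h => exact .orR₂ h
  | weakL hw _ h =>
    simp only [Multiset.map_cons] at *
    exact .weakL hw h
  | weakR hw _ h => exact .weakR hw h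
  | contr hw _ h =>
    simp only [Multiset.map_cons] at *
    exact .contr hw h

/-- The external logic of the calculus: `Φ ⊢ ψ` iff `⇒ ψ` is derivable from the sequents `⇒ φ`
with `φ ∈ Φ`. -/
def externalLogic (w : Prop) : Logic where
  Entails Φ ψ := Derivable w (assertions Φ) 0 (some ψ)
  refl Φ φ h := .hyp ⟨φ, h, rfl⟩
  mono Φ Ψ φ h := Derivable.trans <| by
    rintro _ ⟨χ, hχ, rfl⟩
    exact .hyp ⟨χ, h hχ, rfl⟩
  trans Φ Ψ φ h := Derivable.trans <| by
    rintro _ ⟨χ, hχ, rfl⟩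
    exact h χ hχ
  structural σ Φ φ h := by
    refine Derivable.subst σ ?_ h
    rintro _ ⟨χ, hχ, rfl⟩
    exact ⟨χ.subst σ, ⟨χ, hχ, rfl⟩, rfl⟩

/-- The logic `FLe`: the external logic of the Full Lambek calculus with exchange. -/
def FLe : Logic := externalLogic False

/-- Intuitionistic propositional logic, in the present language: the logic of `LJ`. -/
def IPL : Logic := externalLogic True

theorem Fm.truth_subst (v : ℕ → Bool) (σ : ℕ → Fm) (φ : Fm) :
    (φ.subst σ).truth v = φ.truth fun n => (σ n).truth v := by
  induction φ <;> simp_all [Fm.subst, Fm.truth]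

/-- Classical propositional logic, in the present language: truth-table consequence. -/
def CPL : Logic where
  Entails Φ ψ := ∀ v : ℕ → Bool, (∀ φ ∈ Φ, φ.truth v = true) → ψ.truth v = true
  refl _ φ h _ hv := hv φ h
  mono _ _ _ h hφ v hv := hφ v fun χ hχ => hv χ (h hχ)
  trans _ _ _ h hφ v hv := hφ v fun χ hχ => h χ hχ v hv
  structural σ Φ φ h v hv := by
    rw [Fm.truth_subst]
    refine h _ fun χ hχ => ?_
    rw [← Fm.truth_subst]
    exact hv _ ⟨χ, hχ, rfl⟩

namespace Logic

/-- A substructural logic is an axiomatic extension of `FLe`. -/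
def IsSubstructural (L : Logic) : Prop := L.IsAxiomaticExtensionOf FLe

/-- The Glivenko property holds for `K` relative to `L`: `⊢_L φ` iff `⊢_K ¬¬φ`. -/
def HasGlivenkoProperty (K L : Logic) : Prop :=
  ∀ φ : Fm, L.IsTheorem φ ↔ K.IsTheorem φ.neg.neg

/-- `G` is the Glivenko logic of `FLe` relative to `L`: the least substructural logic for which
the Glivenko property holds relative to `L`. -/
def IsGlivenkoLogic (G L : Logic) : Prop :=
  IsLeast {K : Logic | K.IsSubstructural ∧ K.HasGlivenkoProperty L} G

end Logic

/-! ## Algebras -/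

/-- An `FLe`-algebra: a commutative residuated lattice with a constant `0`; the residual of
multiplication is written `x ⇨ y`. -/
class FLeAlgebra (A : Type*) extends Lattice A, CommMonoid A, Zero A, HImp A where
  residuation : ∀ x y z : A, x * y ≤ z ↔ x ≤ y ⇨ z

/-- Negation `¬x := x → 0` in an `FLe`-algebra. -/
def FLeAlgebra.neg {A : Type*} [FLeAlgebra A] (x : A) : A := x ⇨ 0

/-- The value of a formula (term) in an `FLe`-algebra. -/
def Fm.eval {A : Type*} [FLeAlgebra A] (v : ℕ → A) : Fm → A
  | var n => v n
  | and φ ψ => φ.eval v ⊓ ψ.eval v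
  | or φ ψ => φ.eval v ⊔ ψ.eval v
  | fus φ ψ => φ.eval v * ψ.eval v
  | imp φ ψ => φ.eval v ⇨ ψ.eval v
  | zero => 0
  | one => 1

/-- The binary operation on `A` defined by a term `t` in the variables `p₀, p₁`. -/
def Fm.op (t : Fm) {A : Type*} [FLeAlgebra A] (x y : A) : A :=
  t.eval fun n => if n = 0 then x else y

/-- `A` belongs to the variety `V(L)`: it satisfies `1 ≤ φ` for every theorem `φ` of `L`. -/
def Logic.IsModel (L : Logic) (A : Type*) [FLeAlgebra A] : Prop :=
  ∀ φ : Fm, L.IsTheorem φ → ∀ v : ℕ → A, 1 ≤ φ.eval v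

/-! ## Connexivity -/

/-- Aristotle's and Boethius' theses, for an implication `arr` over a preordered set with a
negation `neg` and a distinguished element `e`. -/
structure IsProtoConnexive {A : Type*} [Preorder A] (neg : A → A) (e : A) (arr : A → A → A) :
    Prop where
  aristotle₁ : ∀ x, e ≤ neg (arr x (neg x))
  aristotle₂ : ∀ x, e ≤ neg (arr (neg x) x)
  boethius₁ : ∀ x y, e ≤ arr (arr x y) (neg (arr x (neg y)))
  boethius₂ : ∀ x y, e ≤ arr (arr x (neg y)) (neg (arr x y))

/-- Connexivity: proto-connexivity and non-symmetry. -/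
def IsConnexive {A : Type*} [Preorder A] (neg : A → A) (e : A) (arr : A → A → A) : Prop :=
  IsProtoConnexive neg e arr ∧ ∃ x y, ¬ arr x y ≤ arr y x ∨ ¬ arr y x ≤ arr x y

namespace Logic

/-- `(L, t)` is proto-connexive: `(A, t)` is, for every `A` in the variety `V(L)`. -/
def IsProtoConnexive (L : Logic) (t : Fm) : Prop :=
  ∀ (A : Type u) [FLeAlgebra A], L.IsModel A →
    Connexive.IsProtoConnexive FLeAlgebra.neg (1 : A) t.op

/-- `(L, t)` is connexive: it is proto-connexive and `(A, t)` is connexive for some `A` in the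
variety `V(L)`. -/
def IsConnexive (L : Logic) (t : Fm) : Prop :=
  IsProtoConnexive.{u} L t ∧
    ∃ (A : Type u) (_ : FLeAlgebra A), L.IsModel A ∧
      Connexive.IsConnexive FLeAlgebra.neg (1 : A) t.op

/-- The first of Boethius' theses, `(φ ⇒ ψ) ⇒ ¬(φ ⇒ ¬ψ)`, is a theorem of `L`. -/
def ProvesBoethius₁ (L : Logic) (t : Fm) : Prop :=
  ∀ φ ψ : Fm, L.IsTheorem (t.conn (t.conn φ ψ) (t.conn φ ψ.neg).neg)

/-- The second of Boethius' theses, `(φ ⇒ ¬ψ) ⇒ ¬(φ ⇒ ψ)`, is a theorem of `L`. -/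
def ProvesBoethius₂ (L : Logic) (t : Fm) : Prop :=
  ∀ φ ψ : Fm, L.IsTheorem (t.conn (t.conn φ ψ.neg) (t.conn φ ψ).neg)

end Logic

/-- The connective `x ⇒∧ y := (x → y) ∧ (y → ¬¬x)`. -/
def arrMeet : Fm :=
  ((Fm.var 0).imp (Fm.var 1)).and ((Fm.var 1).imp (Fm.var 0).neg.neg)

/-- The connective `x ⇒∘ y := (x → y) · (y → ¬¬x)`. -/
def arrCirc : Fm :=
  ((Fm.var 0).imp (Fm.var 1)).fus ((Fm.var 1).imp (Fm.var 0).neg.neg)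

end Connexive

namespace Connexive

open FLeAlgebra

/-! ## Arithmetic of `FLe`-algebras -/

section Algebra

variable {A : Type*} [FLeAlgebra A] {a b c d x y : A}

/-! The least substructural logic with the Glivenko property for CPL always exists: it is FLe plus
the double negations of all tautologies (`isGlivenkoLogic_FLeExtension`). The last item of the list
therefore says that `L` proves ¬¬τ for every tautology τ (`exists_glivenkoLogic_iff`).

Put P = x ⇒ y and Q = x ⇒ ¬y. Up to the order of factors, both Boethius theses reduce to P·Q ≤ 0 and
¬P·¬Q ≤ 0 (`IsBoethius`); for ⇒∘ splitting the outer product uses x·0 ≤ 0. Classically ⇒ is the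
biconditional, so P·Q, ¬P·¬Q, x ⇒ ¬x and ¬x ⇒ x are contradictions. Their negations are thus
theorems as soon as double negations of tautologies are, and proto-connexivity follows
(`isProtoConnexive_of_neg_neg`).

Conversely, well-chosen instances of the two inequalities yield the four conditions of
`IsWeaklyBoolean`. Under these, the preorder `NegLE`, which is 1 ≤ ¬¬(a → b), admits weakening,
contraction, ex falso and proof by cases, so Kalmár's completeness argument gives 1 ≤ ¬¬τ for every
tautology (`one_le_neg_neg_eval`). The Lindenbaum algebra turns this into a statement about
theorems.

Non-symmetry comes for free: the three-element Heyting chain is a model of IPL, hence of `L`. -/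

theorem le_himp_iff_mul_le : a ≤ b ⇨ c ↔ a * b ≤ c := (residuation a b c).symm

theorem le_neg_iff_mul_le : a ≤ neg b ↔ a * b ≤ 0 := le_himp_iff_mul_le

theorem mul_le_mul_right_of_le (h : a ≤ b) (c : A) : a * c ≤ b * c :=
  (residuation a c _).2 (h.trans ((residuation b c _).1 le_rfl))

theorem mul_le_mul_of_le (h₁ : a ≤ b) (h₂ : c ≤ d) : a * c ≤ b * d :=
  (mul_le_mul_right_of_le h₁ c).trans <| by
    rw [mul_comm b c, mul_comm b d]
    exact mul_le_mul_right_of_le h₂ b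

theorem himp_mul_le (a b : A) : (a ⇨ b) * a ≤ b := le_himp_iff_mul_le.1 le_rfl

theorem neg_mul_le (a : A) : neg a * a ≤ 0 := himp_mul_le a 0

theorem one_le_himp_iff : 1 ≤ a ⇨ b ↔ a ≤ b := by rw [le_himp_iff_mul_le, one_mul]

theorem one_le_neg_iff : 1 ≤ neg a ↔ a ≤ 0 := one_le_himp_iff

theorem neg_le_neg_of_le (h : a ≤ b) : neg b ≤ neg a :=
  le_neg_iff_mul_le.2 ((mul_le_mul_of_le le_rfl h).trans (neg_mul_le b))

theorem le_neg_neg (a : A) : a ≤ neg (neg a) :=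
  le_neg_iff_mul_le.2 (by rw [mul_comm]; exact neg_mul_le a)

theorem neg_neg_neg (a : A) : neg (neg (neg a)) = neg a :=
  le_antisymm (neg_le_neg_of_le (le_neg_neg a)) (le_neg_neg _)

theorem neg_one_eq : neg (1 : A) = 0 :=
  le_antisymm (by simpa using neg_mul_le (1 : A)) (le_neg_iff_mul_le.2 (by simp))

theorem one_le_neg_zero : 1 ≤ neg (0 : A) := one_le_neg_iff.2 le_rfl

theorem neg_neg_zero : neg (neg (0 : A)) = 0 := by rw [← neg_one_eq, neg_neg_neg]

theorem himp_le_himp (h₁ : b ≤ a) (h₂ : c ≤ d) : a ⇨ c ≤ b ⇨ d :=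
  le_himp_iff_mul_le.2 (((mul_le_mul_of_le le_rfl h₁).trans (himp_mul_le a c)).trans h₂)

theorem himp_neg_eq (a b : A) : a ⇨ neg b = neg (a * b) := by
  refine le_antisymm (le_neg_iff_mul_le.2 ?_) (le_himp_iff_mul_le.2 (le_neg_iff_mul_le.2 ?_))
  · rw [← mul_assoc]
    exact le_neg_iff_mul_le.1 (himp_mul_le _ _)
  · rw [mul_assoc]
    exact neg_mul_le _

/-- `a` entails `b` up to a double negation. -/
def NegLE (a b : A) : Prop := neg (a ⇨ b) ≤ 0

theorem neg_le_zero_mono (h : a ≤ b) (ha : neg a ≤ 0) : neg b ≤ 0 := (neg_le_neg_of_le h).trans ha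

/-- By currying, ¬(ab) = a → ¬b ≤ a → 0. This closure under products is what makes `NegLE`
transitive and compatible with multiplication. -/
theorem neg_mul_le_zero (ha : neg a ≤ 0) (hb : neg b ≤ 0) : neg (a * b) ≤ 0 := by
  refine le_trans ?_ ha
  rw [← himp_neg_eq]
  exact himp_le_himp le_rfl hb

theorem NegLE.of_le (h : a ≤ b) : NegLE a b :=
  neg_le_zero_mono (one_le_himp_iff.2 h) neg_one_eq.le

theorem NegLE.trans (h₁ : NegLE a b) (h₂ : NegLE b c) : NegLE a c := by
  refine neg_le_zero_mono ?_ (neg_mul_le_zero h₂ h₁)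
  rw [le_himp_iff_mul_le, mul_assoc]
  exact (mul_le_mul_of_le le_rfl (himp_mul_le _ _)).trans (himp_mul_le _ _)

theorem negLE_himp_iff : NegLE a (b ⇨ c) ↔ NegLE (a * b) c := by
  have : a ⇨ (b ⇨ c) = (a * b) ⇨ c := by
    refine le_antisymm (le_himp_iff_mul_le.2 ?_)
      (le_himp_iff_mul_le.2 (le_himp_iff_mul_le.2 ?_))
    · rw [← mul_assoc]
      exact le_himp_iff_mul_le.1 (himp_mul_le _ _)
    · rw [mul_assoc]
      exact himp_mul_le _ _
  rw [NegLE, NegLE, this]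

/-- Since ¬b·a ≤ ¬(a → b) ≤ 0, a relation that holds only up to double negation becomes a genuine
inequality after negating. -/
theorem NegLE.neg_le_neg (h : NegLE a b) : neg b ≤ neg a := by
  refine le_neg_iff_mul_le.2 (le_trans (le_neg_iff_mul_le.2 ?_) h)
  rw [mul_assoc, mul_comm a]
  exact (mul_le_mul_of_le le_rfl (himp_mul_le _ _)).trans (neg_mul_le _)

theorem NegLE.mul_mul (h₁ : NegLE a b) (h₂ : NegLE c d) : NegLE (a * c) (b * d) := by
  refine neg_le_zero_mono ?_ (neg_mul_le_zero h₁ h₂)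
  rw [le_himp_iff_mul_le, mul_mul_mul_comm]
  exact mul_le_mul_of_le (himp_mul_le _ _) (himp_mul_le _ _)

/-- The inequalities that force the double negations of all tautologies. -/
structure IsWeaklyBoolean (A : Type*) [FLeAlgebra A] : Prop where
  mul_zero_le : ∀ x : A, x * 0 ≤ 0
  negLE_one : ∀ x : A, NegLE x 1
  zero_negLE : ∀ x : A, NegLE 0 x
  inf_neg_le : ∀ x : A, x ⊓ neg x ≤ 0

namespace IsWeaklyBoolean

variable (h : IsWeaklyBoolean A)
include h

theorem mul_negLE (a b : A) : NegLE (a * b) a := by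
  simpa using (NegLE.of_le (le_refl a)).mul_mul (h.negLE_one b)

/-- Reduces the meet to the product. The element (a ⊔ b) → 1 sends both a and b below 1, so it sends
ab below a and below b; and its negation is at most 0 by `negLE_one`. -/
theorem neg_inf_le_zero (ha : neg a ≤ 0) (hb : neg b ≤ 0) : neg (a ⊓ b) ≤ 0 := by
  have h₁ : NegLE (a * b) (a ⊓ b) := by
    refine neg_le_zero_mono ?_ (h.negLE_one (a ⊔ b))
    refine le_himp_iff_mul_le.2 (le_inf ?_ ?_)
    · rw [mul_comm a, ← mul_assoc]
      simpa using mul_le_mul_right_of_le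
        (((mul_le_mul_of_le le_rfl le_sup_right).trans (himp_mul_le (a ⊔ b) 1))) a
    · rw [← mul_assoc]
      simpa using mul_le_mul_right_of_le
        (((mul_le_mul_of_le le_rfl le_sup_left).trans (himp_mul_le (a ⊔ b) 1))) b
  exact h₁.neg_le_neg.trans (neg_mul_le_zero ha hb)

theorem mul_neg_le (a b : A) : a * neg b ≤ neg b := by
  refine le_neg_iff_mul_le.2 ?_
  rw [mul_assoc]
  exact (mul_le_mul_of_le le_rfl (neg_mul_le b)).trans (h.mul_zero_le a)

theorem le_zero_of_sq (hs : a * a ≤ 0) : a ≤ 0 :=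
  (le_inf le_rfl (le_neg_iff_mul_le.2 hs)).trans (h.inf_neg_le a)

/-- Contraction up to double negation. With s = ¬(a → a²), ex falso gives s ≤ ¬¬a and weakening
gives s ≤ ¬(a²). Hence s² ≤ ¬a, because ¬(a²) ≤ ¬¬a → ¬a, and s² ≤ ¬¬a, because negations absorb
factors. So s² ≤ 0, and then s ≤ 0. -/
theorem negLE_sq (a : A) : NegLE a (a * a) := by
  have h₁ : neg (a ⇨ a * a) ≤ neg (neg a) :=
    NegLE.neg_le_neg (negLE_himp_iff.2
      ((NegLE.of_le (neg_mul_le a)).trans (h.zero_negLE (a * a))))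
  have h₂ : neg (a ⇨ a * a) ≤ neg (a * a) :=
    NegLE.neg_le_neg (negLE_himp_iff.2 (h.mul_negLE (a * a) a))
  refine h.le_zero_of_sq ((le_inf ?_ ?_).trans (h.inf_neg_le (neg a)))
  · refine (mul_le_mul_of_le h₂ h₁).trans (le_himp_iff_mul_le.1 ?_)
    rw [himp_neg_eq, mul_comm (neg (neg a)), ← himp_neg_eq a (neg (neg a)), neg_neg_neg,
      himp_neg_eq]
  · exact (mul_le_mul_of_le le_rfl h₁).trans (h.mul_neg_le _ _)

theorem negLE_mul (h₁ : NegLE c a) (h₂ : NegLE c b) : NegLE c (a * b) :=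
  (h.negLE_sq c).trans (h₁.mul_mul h₂)

theorem negLE_inf (h₁ : NegLE c a) (h₂ : NegLE c b) : NegLE c (a ⊓ b) := by
  refine neg_le_zero_mono ?_ (h.neg_inf_le_zero h₁ h₂)
  refine le_himp_iff_mul_le.2 (le_inf ?_ ?_)
  · exact le_himp_iff_mul_le.1 inf_le_left
  · exact le_himp_iff_mul_le.1 inf_le_right

/-- Excluded middle in disguise: the hypotheses put ¬(c → a) below both ¬x and ¬¬x, whose meet is at
most 0. -/
theorem negLE_of_cases (h₁ : NegLE (c * x) a) (h₂ : NegLE (c * neg x) a) : NegLE c a := by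
  rw [mul_comm, ← negLE_himp_iff] at h₁ h₂
  exact (le_inf h₁.neg_le_neg h₂.neg_le_neg).trans (h.inf_neg_le (neg x))

end IsWeaklyBoolean

end Algebra

/-! ## Double negations of tautologies -/

/-- `φ` is classically valid. -/
def Fm.IsTautology (φ : Fm) : Prop := ∀ v, φ.truth v = true

/-- All variables of a formula are below the bound. -/
def Fm.VarsBelow (N : ℕ) : Fm → Prop
  | var n => n < N
  | and φ ψ => φ.VarsBelow N ∧ ψ.VarsBelow N
  | or φ ψ => φ.VarsBelow N ∧ ψ.VarsBelow N
  | fus φ ψ => φ.VarsBelow N ∧ ψ.VarsBelow N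
  | imp φ ψ => φ.VarsBelow N ∧ ψ.VarsBelow N
  | zero => True
  | one => True

theorem Fm.VarsBelow.mono {M N : ℕ} (hMN : M ≤ N) {φ : Fm} (h : φ.VarsBelow M) :
    φ.VarsBelow N := by
  induction φ with
  | var n => exact lt_of_lt_of_le h hMN
  | zero => trivial
  | one => trivial
  | _ φ ψ ih₁ ih₂ => exact ⟨ih₁ h.1, ih₂ h.2⟩

theorem Fm.exists_varsBelow (φ : Fm) : ∃ N, φ.VarsBelow N := by
  induction φ with
  | var n => exact ⟨n + 1, Nat.lt_succ_self n⟩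
  | zero => exact ⟨0, trivial⟩
  | one => exact ⟨0, trivial⟩
  | _ φ ψ ih₁ ih₂ =>
    obtain ⟨M, hM⟩ := ih₁
    obtain ⟨N, hN⟩ := ih₂
    exact ⟨max M N, hM.mono (le_max_left _ _), hN.mono (le_max_right _ _)⟩

namespace IsWeaklyBoolean

variable {A : Type*} [FLeAlgebra A] (h : IsWeaklyBoolean A)
include h

/-- Kalmár's lemma: a context that decides the variables of `φ` decides `φ`. -/
theorem decide_eval {N : ℕ} (e : ℕ → A) (c : A) (b : ℕ → Bool)
    (hc : ∀ n < N, NegLE c (if b n then e n else neg (e n))) (φ : Fm) (hφ : φ.VarsBelow N) :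
    NegLE c (if φ.truth b then φ.eval e else neg (φ.eval e)) := by
  induction φ with
  | var n => exact hc n hφ
  | zero =>
    simp only [Fm.truth, Fm.eval, Bool.false_eq_true, if_false]
    exact (h.negLE_one c).trans (.of_le one_le_neg_zero)
  | one =>
    simp only [Fm.truth, Fm.eval, if_true]
    exact h.negLE_one c
  | and φ ψ ih₁ ih₂ =>
    replace ih₁ := ih₁ hφ.1
    replace ih₂ := ih₂ hφ.2
    simp only [Fm.truth, Fm.eval]
    rcases (Bool.eq_false_or_eq_true (φ.truth b)).symm with h₁ | h₁ <;>
      rcases (Bool.eq_false_or_eq_true (ψ.truth b)).symm with h₂ | h₂ <;>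
      simp only [h₁, h₂, Bool.and_true, Bool.and_false, Bool.false_eq_true, if_true,
        if_false] at ih₁ ih₂ ⊢
    · exact ih₁.trans (.of_le (neg_le_neg_of_le inf_le_left))
    · exact ih₁.trans (.of_le (neg_le_neg_of_le inf_le_left))
    · exact ih₂.trans (.of_le (neg_le_neg_of_le inf_le_right))
    · exact h.negLE_inf ih₁ ih₂
  | or φ ψ ih₁ ih₂ =>
    replace ih₁ := ih₁ hφ.1
    replace ih₂ := ih₂ hφ.2
    simp only [Fm.truth, Fm.eval]
    rcases (Bool.eq_false_or_eq_true (φ.truth b)).symm with h₁ | h₁ <;>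
      rcases (Bool.eq_false_or_eq_true (ψ.truth b)).symm with h₂ | h₂ <;>
      simp only [h₁, h₂, Bool.or_true, Bool.or_false, Bool.false_eq_true, if_true,
        if_false] at ih₁ ih₂ ⊢
    · refine (h.negLE_inf ih₁ ih₂).trans (.of_le (le_neg_iff_mul_le.2 ?_))
      rw [mul_comm]
      refine le_himp_iff_mul_le.1 (sup_le (le_himp_iff_mul_le.2 ?_) (le_himp_iff_mul_le.2 ?_))
      · rw [mul_comm]
        exact le_neg_iff_mul_le.1 inf_le_left
      · rw [mul_comm]
        exact le_neg_iff_mul_le.1 inf_le_right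
    · exact ih₂.trans (.of_le le_sup_right)
    · exact ih₁.trans (.of_le le_sup_left)
    · exact ih₁.trans (.of_le le_sup_left)
  | fus φ ψ ih₁ ih₂ =>
    replace ih₁ := ih₁ hφ.1
    replace ih₂ := ih₂ hφ.2
    simp only [Fm.truth, Fm.eval]
    rcases (Bool.eq_false_or_eq_true (φ.truth b)).symm with h₁ | h₁ <;>
      rcases (Bool.eq_false_or_eq_true (ψ.truth b)).symm with h₂ | h₂ <;>
      simp only [h₁, h₂, Bool.and_true, Bool.and_false, Bool.false_eq_true, if_true,
        if_false] at ih₁ ih₂ ⊢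
    · exact ih₁.trans (.of_le (h.mul_negLE _ _).neg_le_neg)
    · exact ih₁.trans (.of_le (h.mul_negLE _ _).neg_le_neg)
    · rw [mul_comm]
      exact ih₂.trans (.of_le (h.mul_negLE _ _).neg_le_neg)
    · exact h.negLE_mul ih₁ ih₂
  | imp φ ψ ih₁ ih₂ =>
    replace ih₁ := ih₁ hφ.1
    replace ih₂ := ih₂ hφ.2
    simp only [Fm.truth, Fm.eval]
    have hneg : NegLE (neg (φ.eval e)) (φ.eval e ⇨ ψ.eval e) :=
      negLE_himp_iff.2 ((NegLE.of_le (neg_mul_le _)).trans (h.zero_negLE _))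
    rcases (Bool.eq_false_or_eq_true (φ.truth b)).symm with h₁ | h₁ <;>
      rcases (Bool.eq_false_or_eq_true (ψ.truth b)).symm with h₂ | h₂ <;>
      simp only [h₁, h₂, Bool.not_true, Bool.not_false, Bool.or_true, Bool.or_false,
        Bool.false_eq_true, if_true, if_false] at ih₁ ih₂ ⊢
    · exact ih₁.trans hneg
    · exact ih₁.trans hneg
    · refine (h.negLE_mul ih₁ ih₂).trans (.of_le (le_neg_iff_mul_le.2 ?_))
      rw [mul_right_comm, mul_comm _ (_ ⇨ _), mul_comm]
      exact (mul_le_mul_of_le le_rfl (himp_mul_le _ _)).trans (neg_mul_le _)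
    · exact ih₂.trans (negLE_himp_iff.2 (h.mul_negLE _ _))

/-- Induction on the number `k` of variables that the context need not decide. Multiplying the
context by the value of variable `k`, or by its negation, decides one more, and the two branches are
merged by cases. -/
theorem negLE_eval_of_decided {N : ℕ} (e : ℕ → A) {φ : Fm} (hφ : φ.VarsBelow N)
    (hT : φ.IsTautology) (k : ℕ) (c : A)
    (hc : ∀ n, k ≤ n → n < N → NegLE c (e n) ∨ NegLE c (neg (e n))) : NegLE c (φ.eval e) := by
  classical
  induction k generalizing c with
  | zero =>
    -- A context that decides every variable determines its own valuation; if it entails both a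
    -- variable and its negation, the value `true` is chosen.
    have := h.decide_eval e c (fun n => decide (NegLE c (e n))) (N := N) (fun n hn => by
      by_cases h' : NegLE c (e n)
      · simp [h']
      · simpa only [h', decide_false, Bool.false_eq_true, if_false] using
          (hc n (Nat.zero_le n) hn).resolve_left h') φ hφ
    simpa [hT _] using this
  | succ k ih =>
    have key : ∀ d, (NegLE d (e k) ∨ NegLE d (neg (e k))) → NegLE (c * d) (φ.eval e) := by
      intro d hd
      refine ih (c * d) fun n hkn hn => ?_
      rcases hkn.eq_or_lt with rfl | hlt
      · rw [mul_comm]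
        exact hd.imp (h.mul_negLE d c).trans (h.mul_negLE d c).trans
      · exact (hc n hlt hn).imp (h.mul_negLE c d).trans (h.mul_negLE c d).trans
    exact h.negLE_of_cases (key _ (.inl (.of_le le_rfl))) (key _ (.inr (.of_le le_rfl)))

theorem one_le_neg_neg_eval (e : ℕ → A) {φ : Fm} (hT : φ.IsTautology) :
    1 ≤ neg (neg (φ.eval e)) := by
  obtain ⟨N, hN⟩ := φ.exists_varsBelow
  -- With `k = N` nothing has to be decided, so the trivial context 1 is allowed.
  have := (h.negLE_eval_of_decided e hN hT N 1 fun n h₁ h₂ =>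
    absurd h₂ (not_lt.2 h₁)).neg_le_neg
  rw [neg_one_eq] at this
  exact one_le_neg_iff.2 this

end IsWeaklyBoolean

/-! ## Consequences of Boethius' theses -/

section Boethius

variable {A : Type*} [FLeAlgebra A]

/-- Boethius' theses for `(x → y) ⋆ (y → ¬¬x)`, stripped of the outermost connective `⋆`. -/
structure IsBoethius (m : A → A → A) : Prop where
  mul_le : ∀ x y : A,
    m (x ⇨ y) (y ⇨ neg (neg x)) * m (x ⇨ neg y) (neg y ⇨ neg (neg x)) ≤ 0
  neg_mul_neg_le : ∀ x y : A,
    neg (m (x ⇨ y) (y ⇨ neg (neg x))) * neg (m (x ⇨ neg y) (neg y ⇨ neg (neg x))) ≤ 0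

/-- The assumptions on `m` are what meet and product have in common once x·0 ≤ 0: it suffices to
annihilate one component, and a first component above the top ¬0 can be dropped. -/
theorem IsBoethius.isWeaklyBoolean {m : A → A → A} (hB : IsBoethius m)
    (h0 : ∀ x : A, x * 0 ≤ 0)
    (hl : ∀ p q n : A, p * n ≤ 0 → m p q * n ≤ 0)
    (hr : ∀ p q n : A, q * n ≤ 0 → m p q * n ≤ 0)
    (h1 : ∀ p q : A, 1 ≤ p → 1 ≤ q → 1 ≤ m p q)
    (htop : ∀ p q : A, neg 0 ≤ p → q ≤ m p q) : IsWeaklyBoolean A := by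
  have le_top : ∀ x : A, x ≤ neg 0 := fun x => le_neg_iff_mul_le.2 (h0 x)
  -- Taking y = x makes the first factor P at least 1.
  have aristotle : ∀ x : A, m (x ⇨ neg x) (neg x ⇨ neg (neg x)) ≤ 0 := fun x => by
    refine le_trans ?_ (hB.mul_le x x)
    simpa using mul_le_mul_right_of_le (h1 (x ⇨ x) (x ⇨ neg (neg x))
      (one_le_himp_iff.2 le_rfl) (one_le_himp_iff.2 (le_neg_neg x))) _
  have negl : ∀ p q : A, neg p ≤ neg (m p q) := fun p q => by
    rw [le_neg_iff_mul_le, mul_comm]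
    exact hl _ _ _ (by rw [mul_comm]; exact neg_mul_le p)
  -- If Q ≤ 0 then 1 ≤ ¬Q, so ¬P·¬Q ≤ 0 leaves ¬P ≤ 0, and ¬(x → y) ≤ ¬P.
  have left_le : ∀ x y : A, m (x ⇨ neg y) (neg y ⇨ neg (neg x)) ≤ 0 → NegLE x y := by
    intro x y hxy
    refine (negl _ (y ⇨ neg (neg x))).trans (le_trans ?_ (hB.neg_mul_neg_le x y))
    simpa using mul_le_mul_of_le le_rfl (one_le_neg_iff.2 hxy)
  refine ⟨h0, fun x => ?_, fun y => ?_, fun x => ?_⟩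
  -- For x = ¬0 and y = 1 the first component of Q is ¬0 → 0 = 0.
  · have : NegLE (neg 0 : A) 1 := by
      refine left_le _ _ ?_
      rw [neg_one_eq]
      simpa using hl (neg 0 ⇨ 0) (0 ⇨ neg (neg (neg 0))) 1
        (by rw [mul_one]; exact neg_neg_zero.le)
    exact (NegLE.of_le (le_top x)).trans this
  -- Replacing y by 0 ⊓ y makes the second component of Q equal to ¬¬(0 ⊓ y) ≤ ¬¬0 = 0.
  · have : NegLE 0 (0 ⊓ y) := by
      refine left_le _ _ ?_
      have := hr (0 ⇨ neg (0 ⊓ y)) (neg (0 ⊓ y) ⇨ neg (neg 0)) 1 (by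
        rw [mul_one, neg_neg_zero]
        exact (neg_le_neg_of_le (neg_le_neg_of_le inf_le_left)).trans neg_neg_zero.le)
      simpa using this
    exact this.trans (.of_le inf_le_right)
  · have hsq : (x ⊓ neg x) * (x ⊓ neg x) ≤ 0 := by
      rw [← le_neg_iff_mul_le]
      exact inf_le_right.trans (neg_le_neg_of_le inf_le_left)
    generalize x ⊓ neg x = z at hsq
    -- As z² ≤ 0, the component z → ¬z = ¬(z²) is the top, so Aristotle's thesis bounds ¬z → ¬¬z by
    -- 0. That element lies above z.
    have h₂ := (htop (z ⇨ neg z) (neg z ⇨ neg (neg z)) (by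
      rw [himp_neg_eq]
      exact neg_le_neg_of_le hsq)).trans (aristotle z)
    refine le_trans ?_ h₂
    rw [himp_neg_eq, le_neg_iff_mul_le, ← mul_assoc, mul_comm z]
    exact (mul_le_mul_right_of_le (neg_mul_le z) _).trans (by rw [mul_comm]; exact h0 _)

/-- For meets, the thesis itself makes ¬0 the top. At the pair 1, ¬x (with x ≥ 1) one has P ≤ ¬x,
and Q ≤ ¬¬x → 0 = ¬x = ¬(x·1), while the component ¬¬x → ¬¬1 equals ¬(x·0). So x ≤ ¬P and x·0 ≤ ¬Q,
whence x·0 ≤ x·(x·0) ≤ 0. -/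
theorem IsBoethius.mul_zero_le (hB : IsBoethius (A := A) (· ⊓ ·)) (x : A) : x * 0 ≤ 0 := by
  wlog hx : 1 ≤ x generalizing x
  · exact (mul_le_mul_right_of_le le_sup_left 0).trans (this (x ⊔ 1) le_sup_right)
  have h := hB.neg_mul_neg_le 1 (neg x)
  have h₁ : x ≤ neg ((1 ⇨ neg x) ⊓ (neg x ⇨ neg (neg 1))) := by
    refine ((le_neg_neg x).trans (neg_le_neg_of_le ?_)).trans (neg_le_neg_of_le inf_le_left)
    rw [himp_neg_eq, one_mul]
  have h₂ : x * 0 ≤ neg ((1 ⇨ neg (neg x)) ⊓ (neg (neg x) ⇨ neg (neg 1))) := by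
    refine ((le_neg_neg _).trans (neg_le_neg_of_le ?_)).trans (neg_le_neg_of_le inf_le_right)
    rw [himp_neg_eq, neg_one_eq, mul_comm, ← himp_neg_eq, neg_neg_neg, himp_neg_eq, mul_comm]
  refine le_trans ?_ ((mul_le_mul_of_le h₁ h₂).trans h)
  simpa using mul_le_mul_right_of_le hx (x * 0)

theorem IsBoethius.isWeaklyBoolean_inf (hB : IsBoethius (A := A) (· ⊓ ·)) :
    IsWeaklyBoolean A :=
  hB.isWeaklyBoolean hB.mul_zero_le
    (fun _ _ n h => (mul_le_mul_right_of_le inf_le_left n).trans h)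
    (fun _ _ n h => (mul_le_mul_right_of_le inf_le_right n).trans h)
    (fun _ _ h₁ h₂ => le_inf h₁ h₂)
    (fun _ q h => le_inf ((le_neg_iff_mul_le.2 (hB.mul_zero_le q)).trans h) le_rfl)

theorem IsBoethius.isWeaklyBoolean_mul (hB : IsBoethius (A := A) (· * ·))
    (h0 : ∀ x : A, x * 0 ≤ 0) : IsWeaklyBoolean A :=
  hB.isWeaklyBoolean h0
    (fun p q n h => by
      rw [mul_right_comm, mul_comm]
      exact (mul_le_mul_of_le le_rfl h).trans (h0 q))
    (fun p q n h => by
      rw [mul_assoc]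
      exact (mul_le_mul_of_le le_rfl h).trans (h0 p))
    (fun _ _ h₁ h₂ => by simpa using mul_le_mul_of_le h₁ h₂)
    (fun p q h => by simpa using mul_le_mul_right_of_le (one_le_neg_zero.trans h) q)

/-- A product of negations lies below each factor, since negations absorb multiplication. This
separates the two halves of the outermost ⇒∘, as `inf_le_left` and `inf_le_right` do for ⇒∧. -/
theorem le_zero_of_one_le_neg_mul_neg (h0 : ∀ x : A, x * 0 ≤ 0) {a b : A}
    (h : 1 ≤ neg a * neg b) : a ≤ 0 ∧ b ≤ 0 := by
  have key : ∀ c d : A, c * neg d ≤ neg d := fun c d => by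
    rw [le_neg_iff_mul_le, mul_assoc]
    exact (mul_le_mul_of_le le_rfl (neg_mul_le d)).trans (h0 c)
  exact ⟨one_le_neg_iff.1 (h.trans (by rw [mul_comm]; exact key _ _)),
    one_le_neg_iff.1 (h.trans (key _ _))⟩

end Boethius

/-! ## Evaluation and substitution -/

theorem Fm.eval_subst {A : Type*} [FLeAlgebra A] (v : ℕ → A) (σ : ℕ → Fm) (φ : Fm) :
    (φ.subst σ).eval v = φ.eval fun n => (σ n).eval v := by
  induction φ <;> simp_all [Fm.subst, Fm.eval]

theorem Fm.eval_conn {A : Type*} [FLeAlgebra A] (v : ℕ → A) (t φ ψ : Fm) :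
    (t.conn φ ψ).eval v = t.op (φ.eval v) (ψ.eval v) := by
  rw [Fm.conn, Fm.eval_subst, Fm.op]
  congr 1
  funext n
  split_ifs <;> rfl

theorem arrCirc_op {A : Type*} [FLeAlgebra A] (x y : A) :
    arrCirc.op x y = (x ⇨ y) * (y ⇨ neg (neg x)) := rfl

theorem Fm.eval_neg {A : Type*} [FLeAlgebra A] (v : ℕ → A) (φ : Fm) :
    φ.neg.eval v = FLeAlgebra.neg (φ.eval v) := rfl

/-! ## Soundness -/

/-- The value of the succedent of a sequent. -/
def evalSucc {A : Type*} [FLeAlgebra A] (v : ℕ → A) : Option Fm → A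
  | none => 0
  | some φ => φ.eval v

/-- `hw` supplies the algebraic forms of left weakening, right weakening and contraction, and is
vacuous for FLe. -/
theorem Derivable.sound {A : Type*} [FLeAlgebra A] {w : Prop} {S : Set Sequent} (v : ℕ → A)
    (hw : w → ∀ x : A, x ≤ 1 ∧ 0 ≤ x ∧ x ≤ x * x)
    (hS : ∀ s ∈ S, (s.1.map (Fm.eval v)).prod ≤ evalSucc v s.2)
    {Γ : Multiset Fm} {P : Option Fm} (h : Derivable w S Γ P) :
    (Γ.map (Fm.eval v)).prod ≤ evalSucc v P := by
  induction h with
  | hyp h => exact hS _ h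
  | id φ => simp [evalSucc]
  | oneR => simp [evalSucc, Fm.eval]
  | zeroL => simp [evalSucc, Fm.eval]
  | cut φ _ _ h₁ h₂ =>
    simp only [Multiset.map_add, Multiset.prod_add, Multiset.map_cons, Multiset.prod_cons,
      evalSucc] at *
    exact (mul_le_mul_right_of_le h₁ _).trans h₂
  | oneL _ h => simpa [Fm.eval] using h
  | zeroR _ h => simpa [evalSucc, Fm.eval] using h
  | fusL _ h => simpa [Fm.eval, mul_assoc] using h
  | fusR _ _ h₁ h₂ =>
    simp only [Multiset.map_add, Multiset.prod_add, evalSucc] at *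
    exact mul_le_mul_of_le h₁ h₂
  | impL _ _ h₁ h₂ =>
    simp only [Multiset.map_add, Multiset.prod_add, Multiset.map_cons, Multiset.prod_cons,
      evalSucc, Fm.eval] at *
    rw [← mul_assoc]
    exact (mul_le_mul_right_of_le ((mul_le_mul_of_le le_rfl h₁).trans (himp_mul_le _ _)) _).trans h₂
  | impR _ h =>
    simp only [Multiset.map_cons, Multiset.prod_cons, evalSucc, Fm.eval] at *
    rw [le_himp_iff_mul_le, mul_comm]
    exact h
  | andL₁ _ h =>
    simp only [Multiset.map_cons, Multiset.prod_cons, Fm.eval] at *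
    exact (mul_le_mul_right_of_le inf_le_left _).trans h
  | andL₂ _ h =>
    simp only [Multiset.map_cons, Multiset.prod_cons, Fm.eval] at *
    exact (mul_le_mul_right_of_le inf_le_right _).trans h
  | andR _ _ h₁ h₂ => exact le_inf h₁ h₂
  | orL _ _ h₁ h₂ =>
    simp only [Multiset.map_cons, Multiset.prod_cons, Fm.eval] at *
    exact le_himp_iff_mul_le.1 (sup_le (le_himp_iff_mul_le.2 h₁) (le_himp_iff_mul_le.2 h₂))
  | orR₁ _ h => exact le_sup_of_le_left h
  | orR₂ _ h => exact le_sup_of_le_right h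
  | weakL hw' _ h =>
    simp only [Multiset.map_cons, Multiset.prod_cons] at *
    exact (mul_le_mul_right_of_le (hw hw' _).1 _).trans (by simpa using h)
  | weakR hw' _ h => exact h.trans (hw hw' _).2.1
  | contr hw' _ h =>
    simp only [Multiset.map_cons, Multiset.prod_cons, ← mul_assoc] at *
    exact (mul_le_mul_right_of_le (hw hw' _).2.2 _).trans h

theorem one_le_eval_of_derivable {A : Type*} [FLeAlgebra A] {w : Prop} {Φ : Set Fm} (v : ℕ → A)
    (hw : w → ∀ x : A, x ≤ 1 ∧ 0 ≤ x ∧ x ≤ x * x) (hΦ : ∀ φ ∈ Φ, 1 ≤ φ.eval v)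
    {ψ : Fm} (h : Derivable w (assertions Φ) 0 (some ψ)) : 1 ≤ ψ.eval v := by
  have := h.sound v hw (by
    rintro _ ⟨χ, hχ, rfl⟩
    simpa [evalSucc] using hΦ χ hχ)
  simpa [evalSucc] using this

/-- A Heyting algebra as an `FLe`-algebra. -/
abbrev heytingFLeAlgebra (A : Type*) [HeytingAlgebra A] : FLeAlgebra A where
  mul := (· ⊓ ·)
  one := ⊤
  zero := ⊥
  mul_assoc := inf_assoc
  mul_comm := inf_comm
  one_mul := top_inf_eq
  mul_one := inf_top_eq
  residuation _ _ _ := le_himp_iff.symm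

theorem isModel_IPL_heyting (A : Type*) [HeytingAlgebra A] :
    letI := heytingFLeAlgebra A
    IPL.IsModel A := by
  let _ := heytingFLeAlgebra A
  intro φ h v
  exact one_le_eval_of_derivable v
    (fun _ x => ⟨le_top (a := x), bot_le (a := x), le_inf (a := x) le_rfl le_rfl⟩) (by simp) h

theorem Logic.IsModel.mono {L K : Logic} (hLK : L ≤ K) {A : Type*} [FLeAlgebra A]
    (h : K.IsModel A) : L.IsModel A := fun φ hφ => h φ (hLK ∅ φ hφ)

theorem eval_bool_eq_truth (v : ℕ → Bool) (φ : Fm) :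
    letI := heytingFLeAlgebra Bool
    φ.eval v = φ.truth v := by
  let _ := heytingFLeAlgebra Bool
  induction φ with
  | var n => rfl
  | zero => rfl
  | one => rfl
  | and φ ψ ih₁ ih₂ => exact congrArg₂ _ ih₁ ih₂
  | or φ ψ ih₁ ih₂ => exact congrArg₂ _ ih₁ ih₂
  | fus φ ψ ih₁ ih₂ => exact congrArg₂ _ ih₁ ih₂
  | imp φ ψ ih₁ ih₂ =>
    simp only [Fm.eval, Fm.truth, ih₁, ih₂]
    cases φ.truth v <;> cases ψ.truth v <;> rfl

theorem FLe_le_CPL : FLe ≤ CPL := by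
  intro Φ ψ h v hv
  let _ := heytingFLeAlgebra Bool
  have : (⊤ : Bool) ≤ ψ.eval v := one_le_eval_of_derivable v False.elim (fun φ hφ => by
    rw [eval_bool_eq_truth, hv φ hφ]
    exact le_top (α := Bool)) h
  rw [eval_bool_eq_truth] at this
  exact top_le_iff.1 this

/-! ## The Glivenko logic -/

/-- The axiomatic extension of `FLe` by a substitution-closed set of axioms. -/
def FLeExtension (B : Set Fm) (hB : ∀ σ : ℕ → Fm, ∀ φ ∈ B, φ.subst σ ∈ B) : Logic where
  Entails Γ φ := FLe.Entails (Γ ∪ B) φ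
  refl Γ φ h := FLe.refl _ _ (.inl h)
  mono Γ Δ φ h := FLe.mono _ _ _ (Set.union_subset_union_left B h)
  trans Γ Δ φ h := FLe.trans _ _ _ fun ψ hψ =>
    hψ.elim (h ψ) fun hψ => FLe.refl _ _ (.inr hψ)
  structural σ Γ φ h := by
    refine FLe.mono _ _ _ ?_ (FLe.structural σ _ _ h)
    rintro _ ⟨χ, hχ | hχ, rfl⟩
    · exact .inl ⟨χ, hχ, rfl⟩
    · exact .inr (hB σ χ hχ)

/-- The double negations of tautologies. -/
def negNegTautologies : Set Fm := {χ | ∃ φ : Fm, φ.IsTautology ∧ χ = φ.neg.neg}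

theorem subst_mem_negNegTautologies (σ : ℕ → Fm) :
    ∀ φ ∈ negNegTautologies, φ.subst σ ∈ negNegTautologies := by
  rintro _ ⟨φ, hφ, rfl⟩
  exact ⟨φ.subst σ, fun v => by rw [Fm.truth_subst]; exact hφ _, rfl⟩

theorem isTheorem_CPL_iff {φ : Fm} : CPL.IsTheorem φ ↔ φ.IsTautology :=
  ⟨fun h v => h v (by simp), fun h v _ => h v⟩

theorem truth_neg_neg (v : ℕ → Bool) (φ : Fm) : φ.neg.neg.truth v = φ.truth v := by
  simp [Fm.neg, Fm.truth]

theorem Logic.IsSubstructural.entails_of_FLe {K : Logic} (hK : K.IsSubstructural) {Γ : Set Fm}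
    {φ : Fm} (h : FLe.Entails Γ φ) : K.Entails Γ φ := by
  obtain ⟨B, -, hB⟩ := hK
  exact (hB Γ φ).2 (FLe.mono _ _ _ Set.subset_union_left h)

/-- A formula and its double negation have the same truth value, so the added axioms are classically
sound; any competitor proves them by its own Glivenko property. -/
theorem isGlivenkoLogic_FLeExtension :
    (FLeExtension negNegTautologies subst_mem_negNegTautologies).IsGlivenkoLogic CPL := by
  refine ⟨⟨⟨_, subst_mem_negNegTautologies, fun _ _ => Iff.rfl⟩,
    fun φ => ⟨fun h => ?_, fun h => ?_⟩⟩, ?_⟩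
  · exact FLe.refl _ _ (.inr ⟨φ, isTheorem_CPL_iff.1 h, rfl⟩)
  · refine isTheorem_CPL_iff.2 fun v => ?_
    rw [← truth_neg_neg]
    refine FLe_le_CPL _ _ h v ?_
    rintro _ (h | ⟨χ, hχ, rfl⟩)
    · exact h.elim
    · rw [truth_neg_neg]
      exact hχ v
  · rintro K ⟨hK, hG⟩ Γ φ h
    refine K.trans _ _ _ ?_ (hK.entails_of_FLe h)
    rintro _ (h | ⟨χ, hχ, rfl⟩)
    · exact K.refl _ _ h
    · exact K.mono _ _ _ (Set.empty_subset Γ) ((hG χ).1 (isTheorem_CPL_iff.2 hχ))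

theorem exists_glivenkoLogic_iff {L : Logic} (hL : L.IsSubstructural) :
    (∃ G : Logic, G.IsGlivenkoLogic CPL ∧ L.IsAxiomaticExtensionOf G) ↔
      ∀ φ : Fm, φ.IsTautology → L.IsTheorem φ.neg.neg := by
  constructor
  · rintro ⟨G, hG, B, -, hB⟩ φ hφ
    exact (hB _ _).2 (G.mono _ _ _ (Set.empty_subset _)
      ((hG.1.2 φ).1 (isTheorem_CPL_iff.2 hφ)))
  · intro h
    obtain ⟨B, hBσ, hB⟩ := hL
    -- The axioms of `L` over FLe also serve over the Glivenko logic, whose own axioms are already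
    -- derivable from them.
    refine ⟨_, isGlivenkoLogic_FLeExtension, B, hBσ, fun Γ φ => (hB Γ φ).trans
      ⟨FLe.mono _ _ _ Set.subset_union_left, FLe.trans _ _ _ ?_⟩⟩
    rintro _ (hψ | ⟨χ, hχ, rfl⟩)
    · exact FLe.refl _ _ hψ
    · exact FLe.mono _ _ _ (by simp) ((hB _ _).1 (h χ hχ))

/-! ## Lindenbaum algebras -/

section Lindenbaum

variable (B : Set Fm)

/-- Derivability of `φ ⇒ ψ` from the axioms `B`. -/
abbrev Below (φ ψ : Fm) : Prop := Derivable False (assertions B) {φ} (some ψ)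

variable {B}

namespace Below

variable {φ ψ χ φ' ψ' : Fm}

theorem trans (h₁ : Below B φ ψ) (h₂ : Below B ψ χ) : Below B φ χ := by
  simpa using Derivable.cut (Δ := 0) ψ h₁ h₂

theorem and_le_left : Below B (φ.and ψ) φ := Derivable.andL₁ (.id φ)

theorem and_le_right : Below B (φ.and ψ) ψ := Derivable.andL₂ (.id ψ)

theorem le_and (h₁ : Below B χ φ) (h₂ : Below B χ ψ) : Below B χ (φ.and ψ) := .andR h₁ h₂

theorem left_le_or : Below B φ (φ.or ψ) := .orR₁ (.id φ)

theorem right_le_or : Below B ψ (φ.or ψ) := .orR₂ (.id ψ)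

theorem or_le (h₁ : Below B φ χ) (h₂ : Below B ψ χ) : Below B (φ.or ψ) χ :=
  Derivable.orL (Γ := 0) h₁ h₂

theorem fus_le_iff : Below B (φ.fus ψ) χ ↔ Derivable False (assertions B) {φ, ψ} (some χ) :=
  ⟨fun h => by
    simpa using Derivable.cut (Δ := 0) _ (Derivable.fusR (.id φ) (.id ψ)) h,
    fun h => Derivable.fusL (Γ := 0) h⟩

theorem fus_fus (h₁ : Below B φ φ') (h₂ : Below B ψ ψ') : Below B (φ.fus ψ) (φ'.fus ψ') :=
  fus_le_iff.2 (Derivable.fusR h₁ h₂)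

theorem fus_comm : Below B (φ.fus ψ) (ψ.fus φ) :=
  fus_le_iff.2 <| by
    rw [Multiset.pair_comm]
    exact Derivable.fusR (.id ψ) (.id φ)

theorem fus_assoc : Below B ((φ.fus ψ).fus χ) (φ.fus (ψ.fus χ)) :=
  fus_le_iff.2 <| Derivable.fusL (Γ := {χ}) <|
    Derivable.fusR (.id φ) (Derivable.fusR (.id ψ) (.id χ))

theorem residuation : Below B (φ.fus ψ) χ ↔ Below B φ (ψ.imp χ) := by
  rw [fus_le_iff]
  constructor
  · intro h
    refine .impR ?_
    change Derivable _ _ {ψ, φ} _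
    rwa [Multiset.pair_comm]
  · intro h
    have := Derivable.cut (Δ := {ψ}) _ h
      (Derivable.impL (Δ := 0) (.id ψ) (.id χ))
    exact this

theorem one_fus : Below B (Fm.one.fus φ) φ := fus_le_iff.2 (.oneL (.id φ))

theorem le_one_fus : Below B φ (Fm.one.fus φ) := by
  simpa using Derivable.fusR (S := assertions B) (w := False) .oneR (.id φ)

theorem imp_imp (h₁ : Below B φ' φ) (h₂ : Below B ψ ψ') : Below B (φ.imp ψ) (φ'.imp ψ') :=
  residuation.1 (((fus_fus (.id _) h₁).trans (residuation.2 (.id _))).trans h₂)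

theorem one_le_iff : Below B .one φ ↔ Derivable False (assertions B) 0 (some φ) :=
  ⟨fun h => by simpa using Derivable.cut (Δ := 0) _ .oneR h, fun h => .oneL h⟩

end Below

variable (B)

/-- Interderivability, on a copy of the formulas in any universe. -/
def lindenbaumSetoid : Setoid (ULift.{u} Fm) where
  r φ ψ := Below B φ.down ψ.down ∧ Below B ψ.down φ.down
  iseqv := ⟨fun _ => ⟨.id _, .id _⟩, fun h => ⟨h.2, h.1⟩,
    fun h₁ h₂ => ⟨h₁.1.trans h₂.1, h₂.2.trans h₁.2⟩⟩

/-- The Lindenbaum algebra of the axiomatic extension of `FLe` by `B`. -/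
def Lindenbaum : Type u := Quotient (lindenbaumSetoid.{u} B)

namespace Lindenbaum

/-- The class of a formula. -/
def mk (φ : Fm) : Lindenbaum.{u} B := Quotient.mk (lindenbaumSetoid B) ⟨φ⟩

variable {B}

theorem ind {p : Lindenbaum.{u} B → Prop} (h : ∀ φ, p (mk B φ)) (x : Lindenbaum.{u} B) : p x :=
  Quotient.ind (fun φ => h φ.down) x

theorem sound {φ ψ : Fm} (h₁ : Below B φ ψ) (h₂ : Below B ψ φ) :
    mk.{u} B φ = mk B ψ := Quotient.sound ⟨h₁, h₂⟩

/-- The binary operation induced by a connective. -/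
def lift₂ (f : Fm → Fm → Fm)
    (hf : ∀ φ φ' ψ ψ', Below B φ φ' → Below B φ' φ → Below B ψ ψ' → Below B ψ' ψ →
      Below B (f φ ψ) (f φ' ψ')) (x y : Lindenbaum.{u} B) : Lindenbaum.{u} B :=
  Quotient.liftOn₂ x y (fun φ ψ => mk B (f φ.down ψ.down)) fun _ _ _ _ h₁ h₂ =>
    sound (hf _ _ _ _ h₁.1 h₁.2 h₂.1 h₂.2) (hf _ _ _ _ h₁.2 h₁.1 h₂.2 h₂.1)

instance : FLeAlgebra (Lindenbaum.{u} B) where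
  le x y := Quotient.liftOn₂ x y (fun φ ψ => Below B φ.down ψ.down) fun _ _ _ _ h₁ h₂ =>
    propext ⟨fun h => (h₁.2.trans h).trans h₂.1, fun h => (h₁.1.trans h).trans h₂.2⟩
  le_refl := ind fun _ => .id _
  le_trans := ind fun _ => ind fun _ => ind fun _ => Below.trans
  le_antisymm := ind fun _ => ind fun _ => sound
  inf := lift₂ .and fun _ _ _ _ h₁ _ h₂ _ =>
    .le_and (Below.and_le_left.trans h₁) (Below.and_le_right.trans h₂)
  sup := lift₂ .or fun _ _ _ _ h₁ _ h₂ _ =>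
    .or_le (h₁.trans .left_le_or) (h₂.trans .right_le_or)
  mul := lift₂ .fus fun _ _ _ _ h₁ _ h₂ _ => .fus_fus h₁ h₂
  himp := lift₂ .imp fun _ _ _ _ _ h₁ h₂ _ => .imp_imp h₁ h₂
  one := mk B .one
  zero := mk B .zero
  inf_le_left := ind fun _ => ind fun _ => Below.and_le_left
  inf_le_right := ind fun _ => ind fun _ => Below.and_le_right
  le_inf := ind fun _ => ind fun _ => ind fun _ => Below.le_and
  le_sup_left := ind fun _ => ind fun _ => Below.left_le_or
  le_sup_right := ind fun _ => ind fun _ => Below.right_le_or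
  sup_le := ind fun _ => ind fun _ => ind fun _ => Below.or_le
  mul_assoc := ind fun _ => ind fun _ => ind fun _ => sound .fus_assoc
    -- The reverse inclusion is `fus_assoc` conjugated by commutativity.
    (Below.fus_comm.trans ((Below.fus_fus .fus_comm (.id _)).trans
      (Below.fus_assoc.trans (Below.fus_comm.trans (.fus_fus .fus_comm (.id _))))))
  mul_comm := ind fun _ => ind fun _ => sound .fus_comm .fus_comm
  one_mul := ind fun _ => sound .one_fus .le_one_fus
  mul_one := ind fun _ => sound (Below.fus_comm.trans .one_fus) (Below.le_one_fus.trans .fus_comm)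
  residuation := ind fun _ => ind fun _ => ind fun _ => Below.residuation

theorem one_le_mk_iff {φ : Fm} :
    1 ≤ mk.{u} B φ ↔ Derivable False (assertions B) 0 (some φ) := Below.one_le_iff

theorem eval_mk (σ : ℕ → Fm) (φ : Fm) :
    φ.eval (fun n => mk.{u} B (σ n)) = mk B (φ.subst σ) := by
  induction φ with
  | var n => rfl
  | zero => rfl
  | one => rfl
  | and φ ψ ih₁ ih₂ => exact congrArg₂ (· ⊓ ·) ih₁ ih₂
  | or φ ψ ih₁ ih₂ => exact congrArg₂ (· ⊔ ·) ih₁ ih₂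
  | fus φ ψ ih₁ ih₂ => exact congrArg₂ (· * ·) ih₁ ih₂
  | imp φ ψ ih₁ ih₂ => exact congrArg₂ (· ⇨ ·) ih₁ ih₂

theorem subst_var (φ : Fm) : φ.subst .var = φ := by
  induction φ <;> simp_all [Fm.subst]

theorem eval_mk_var (φ : Fm) : φ.eval (fun n => mk.{u} B (.var n)) = mk B φ := by
  rw [eval_mk, subst_var]

theorem mk_neg (φ : Fm) : mk.{u} B φ.neg = neg (mk B φ) := rfl

theorem mk_conn (t φ ψ : Fm) : mk.{u} B (t.conn φ ψ) = t.op (mk B φ) (mk B ψ) := by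
  rw [← eval_mk_var, Fm.eval_conn, eval_mk_var, eval_mk_var]

end Lindenbaum

end Lindenbaum

/-- Completeness: every substructural logic is determined by its Lindenbaum algebra. -/
theorem Logic.IsSubstructural.exists_lindenbaum {L : Logic} (hL : L.IsSubstructural) :
    ∃ B : Set Fm, L.IsModel (Lindenbaum.{u} B) ∧
      ∀ φ, L.IsTheorem φ ↔ 1 ≤ Lindenbaum.mk.{u} B φ := by
  obtain ⟨B, -, hB⟩ := hL
  have key : ∀ φ, L.IsTheorem φ ↔ 1 ≤ Lindenbaum.mk.{u} B φ := fun φ => by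
    rw [Lindenbaum.one_le_mk_iff, Logic.IsTheorem, hB, Set.empty_union]
    rfl
  refine ⟨B, fun φ hφ v => ?_, key⟩
  -- Every valuation in the Lindenbaum algebra comes from a substitution, so structurality of `L`
  -- covers all valuations.
  have hout : ∀ x : Lindenbaum.{u} B, ∃ ψ, x = Lindenbaum.mk B ψ := Lindenbaum.ind fun ψ => ⟨ψ, rfl⟩
  choose σ hσ using fun n => hout (v n)
  obtain rfl : v = fun n => Lindenbaum.mk B (σ n) := funext hσ
  rw [Lindenbaum.eval_mk, ← key]
  simpa [Logic.IsTheorem] using L.structural σ ∅ φ hφ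

/-! ## The equivalences -/

section Equivalences

variable {A : Type*}

/-- An element whose pseudocomplement is `⊥` but which is not `⊤` witnesses that the connective
is not symmetric. -/
theorem not_op_top_le [HeytingAlgebra A] {t : Fm}
    (ht : ∀ x y : A, @Fm.op t A (heytingFLeAlgebra A) x y = (x ⇨ y) ⊓ (y ⇨ (x ⇨ ⊥) ⇨ ⊥))
    {y : A} (hy : y ≠ ⊤) (hc : yᶜ = ⊥) :
    ¬ @Fm.op t A (heytingFLeAlgebra A) y ⊤ ≤ @Fm.op t A (heytingFLeAlgebra A) ⊤ y := by
  intro h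
  rw [ht, ht, himp_bot y, hc, himp_self, himp_top, himp_top, top_inf_eq, top_himp] at h
  exact hy (top_le_iff.1 (h.trans inf_le_left))

theorem exists_isModel_not_symm (t : Fm)
    (ht : ∀ (A : Type u) [HeytingAlgebra A] (x y : A),
      @Fm.op t A (heytingFLeAlgebra A) x y = (x ⇨ y) ⊓ (y ⇨ (x ⇨ ⊥) ⇨ ⊥)) :
    ∃ (A : Type u) (_ : FLeAlgebra A), IPL.IsModel A ∧
      ∃ x y : A, ¬ t.op x y ≤ t.op y x ∨ ¬ t.op y x ≤ t.op x y := by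
  let _ : HeytingAlgebra (WithTop (WithBot PUnit.{u + 1})) :=
    (LinearOrder.toBiheytingAlgebra _).toHeytingAlgebra
  -- The middle element of the three-element chain, formed over `PUnit` to live in the required
  -- universe.
  let y : WithTop (WithBot PUnit.{u + 1}) := ((PUnit.unit : WithBot PUnit) : WithTop _)
  have hc : yᶜ = ⊥ := if_neg (by
    change ((PUnit.unit : WithBot PUnit) : WithTop (WithBot PUnit)) ≠
      ((⊥ : WithBot PUnit) : WithTop _)
    simp)
  exact ⟨_, heytingFLeAlgebra (WithTop (WithBot PUnit.{u + 1})), isModel_IPL_heyting _, y, ⊤,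
    .inl (not_op_top_le (ht _) (WithTop.coe_ne_top) hc)⟩

variable [FLeAlgebra A]

/-- The negation of a contradiction is a tautology, and ¬¬¬ collapses to ¬. -/
theorem one_le_neg_eval
    (hA : ∀ (v : ℕ → A) (φ : Fm), φ.IsTautology → 1 ≤ neg (neg (φ.eval v))) (v : ℕ → A) {φ : Fm}
    (hφ : ∀ b, φ.truth b = false) : 1 ≤ neg (φ.eval v) := by
  have := hA v φ.neg fun b => by simp [Fm.neg, Fm.truth, hφ]
  rwa [Fm.eval_neg, neg_neg_neg] at this

theorem isProtoConnexive_of_neg_neg {t : Fm}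
    (ht : ∀ v φ ψ, (t.conn φ ψ).truth v = (φ.truth v == ψ.truth v))
    (hm : ∀ x y : A, x ≤ y → y ≤ neg (neg x) → 1 ≤ t.op x y)
    (hA : ∀ (v : ℕ → A) (φ : Fm), φ.IsTautology → 1 ≤ neg (neg (φ.eval v))) :
    Connexive.IsProtoConnexive neg (1 : A) t.op := by
  have hneg : ∀ (b : ℕ → Bool) (φ : Fm), φ.neg.truth b = !φ.truth b := by
    simp [Fm.neg, Fm.truth]
  refine ⟨fun x => ?_, fun x => ?_, fun x y => ?_, fun x y => ?_⟩
  · have := one_le_neg_eval hA (fun _ => x) (φ := t.conn (.var 0) (Fm.var 0).neg)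
      (by simp [ht, hneg])
    rwa [Fm.eval_conn] at this
  · have := one_le_neg_eval hA (fun _ => x) (φ := t.conn (Fm.var 0).neg (.var 0))
      (by simp [ht, hneg])
    rwa [Fm.eval_conn] at this
  all_goals
    -- P·Q and ¬P·¬Q are contradictions, because a classical biconditional changes its value when
    -- one side is negated.
    have h₁ := one_le_neg_eval hA (fun n => if n = 0 then x else y)
      (φ := (t.conn (.var 0) (.var 1)).fus (t.conn (.var 0) (Fm.var 1).neg))
      (fun b => by
        simp only [ht, hneg, Fm.truth]
        cases b 0 <;> cases b 1 <;> rfl)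
    have h₂ := one_le_neg_eval hA (fun n => if n = 0 then x else y)
      (φ := (t.conn (.var 0) (.var 1)).neg.fus (t.conn (.var 0) (Fm.var 1).neg).neg)
      (fun b => by
        simp only [ht, hneg, Fm.truth]
        cases b 0 <;> cases b 1 <;> rfl)
    simp only [Fm.eval, Fm.eval_conn, Fm.eval_neg, one_le_neg_iff, if_true, one_ne_zero,
      if_false] at h₁ h₂
  · refine hm _ _ (le_neg_iff_mul_le.2 h₁) (le_neg_iff_mul_le.2 ?_)
    rwa [mul_comm]
  · refine hm _ _ (le_neg_iff_mul_le.2 ?_) (le_neg_iff_mul_le.2 h₂)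
    rwa [mul_comm]

end Equivalences

/-- The common form of the equivalences for the two connectives. -/
theorem tfae_of_isWeaklyBoolean {L : Logic} (hL : L.IsSubstructural) (hIPL : L ≤ IPL) {t : Fm}
    (ht : ∀ v φ ψ, (t.conn φ ψ).truth v = (φ.truth v == ψ.truth v))
    (hH : ∀ (A : Type u) [HeytingAlgebra A] (x y : A),
      @Fm.op t A (heytingFLeAlgebra A) x y = (x ⇨ y) ⊓ (y ⇨ (x ⇨ ⊥) ⇨ ⊥))
    (hm : ∀ (A : Type u) [FLeAlgebra A] (x y : A), x ≤ y → y ≤ neg (neg x) → 1 ≤ t.op x y)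
    (hW : ∀ (A : Type u) [FLeAlgebra A], L.IsModel A →
      ((∀ x y : A, 1 ≤ t.op (t.op x y) (neg (t.op x (neg y)))) ∨
        ∀ x y : A, 1 ≤ t.op (t.op x (neg y)) (neg (t.op x y))) → IsWeaklyBoolean A) :
    List.TFAE
      [ Logic.IsConnexive.{u} L t, Logic.IsProtoConnexive.{u} L t, L.ProvesBoethius₁ t,
        L.ProvesBoethius₂ t,
        ∃ G : Logic, G.IsGlivenkoLogic CPL ∧ L.IsAxiomaticExtensionOf G ] := by
  obtain ⟨B, hmod, hthm⟩ := hL.exists_lindenbaum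
  rw [exists_glivenkoLogic_iff hL]
  have glivenko : IsWeaklyBoolean (Lindenbaum.{u} B) →
      ∀ φ : Fm, φ.IsTautology → L.IsTheorem φ.neg.neg := fun h φ hφ => by
    have := h.one_le_neg_neg_eval (fun n => Lindenbaum.mk B (.var n)) hφ
    rw [Lindenbaum.eval_mk_var] at this
    exact (hthm _).2 this
  tfae_have 1 → 2 := fun h => h.1
  tfae_have 2 → 1 := fun h => by
    obtain ⟨A, hA, hAmod, hAsymm⟩ := exists_isModel_not_symm t hH
    exact ⟨h, A, hA, hAmod.mono hIPL, h A (hAmod.mono hIPL), hAsymm⟩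
  tfae_have 2 → 3 := fun h φ ψ => by
    simpa only [hthm, Lindenbaum.mk_conn, Lindenbaum.mk_neg] using
      (h _ hmod).boethius₁ (Lindenbaum.mk B φ) (Lindenbaum.mk B ψ)
  tfae_have 2 → 4 := fun h φ ψ => by
    simpa only [hthm, Lindenbaum.mk_conn, Lindenbaum.mk_neg] using
      (h _ hmod).boethius₂ (Lindenbaum.mk B φ) (Lindenbaum.mk B ψ)
  tfae_have 3 → 5 := fun h => glivenko <| hW _ hmod <| .inl <|
    Lindenbaum.ind fun φ => Lindenbaum.ind fun ψ => by
      simpa only [hthm, Lindenbaum.mk_conn, Lindenbaum.mk_neg] using h φ ψ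
  tfae_have 4 → 5 := fun h => glivenko <| hW _ hmod <| .inr <|
    Lindenbaum.ind fun φ => Lindenbaum.ind fun ψ => by
      simpa only [hthm, Lindenbaum.mk_conn, Lindenbaum.mk_neg] using h φ ψ
  tfae_have 5 → 2 := fun h A _ hA =>
    -- Proto-connexivity ranges over all models; this implication needs only soundness, not the
    -- Lindenbaum algebra.
    isProtoConnexive_of_neg_neg ht (hm A) fun v φ hφ => hA _ (h φ hφ) v
  tfae_finish

theorem tfae_arrMeet {L : Logic} (hL : L.IsSubstructural) (hIPL : L ≤ IPL) :
    List.TFAE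
      [ Logic.IsConnexive.{u} L arrMeet, Logic.IsProtoConnexive.{u} L arrMeet,
        L.ProvesBoethius₁ arrMeet, L.ProvesBoethius₂ arrMeet,
        ∃ G : Logic, G.IsGlivenkoLogic CPL ∧ L.IsAxiomaticExtensionOf G ] := by
  refine tfae_of_isWeaklyBoolean hL hIPL ?_ (fun _ _ _ _ => rfl)
    (fun _ _ _ _ h₁ h₂ => le_inf (one_le_himp_iff.2 h₁) (one_le_himp_iff.2 h₂)) ?_
  · intro v φ ψ
    simp only [arrMeet, Fm.conn, Fm.subst, Fm.neg, Fm.truth, if_true, one_ne_zero, if_false]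
    cases φ.truth v <;> cases ψ.truth v <;> rfl
  · rintro A _ - (h | h)
    · refine IsBoethius.isWeaklyBoolean_inf ⟨fun x y => ?_, fun x y => ?_⟩
      · exact le_neg_iff_mul_le.1 (one_le_himp_iff.1 ((h x y).trans inf_le_left))
      · rw [mul_comm]
        exact le_neg_iff_mul_le.1 (one_le_himp_iff.1 ((h x y).trans inf_le_right))
    · refine IsBoethius.isWeaklyBoolean_inf ⟨fun x y => ?_, fun x y => ?_⟩
      · rw [mul_comm]
        exact le_neg_iff_mul_le.1 (one_le_himp_iff.1 ((h x y).trans inf_le_left))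
      · exact le_neg_iff_mul_le.1 (one_le_himp_iff.1 ((h x y).trans inf_le_right))

theorem tfae_arrCirc {L : Logic} (hL : L.IsSubstructural) (hIPL : L ≤ IPL)
    (htop : ∀ φ : Fm, L.IsTheorem (φ.imp Fm.one.neg.neg)) :
    List.TFAE
      [ Logic.IsConnexive.{u} L arrCirc, Logic.IsProtoConnexive.{u} L arrCirc,
        L.ProvesBoethius₁ arrCirc, L.ProvesBoethius₂ arrCirc,
        ∃ G : Logic, G.IsGlivenkoLogic CPL ∧ L.IsAxiomaticExtensionOf G ] := by
  refine tfae_of_isWeaklyBoolean hL hIPL ?_ (fun _ _ _ _ => rfl)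
    (fun _ _ x y h₁ h₂ => by
      simpa [arrCirc_op] using mul_le_mul_of_le (one_le_himp_iff.2 h₁) (one_le_himp_iff.2 h₂)) ?_
  · intro v φ ψ
    simp only [arrCirc, Fm.conn, Fm.subst, Fm.neg, Fm.truth, if_true, one_ne_zero, if_false]
    cases φ.truth v <;> cases ψ.truth v <;> rfl
  · intro A _ hA h
    -- The extra hypothesis, with ¬¬1 = ¬0, replaces the derivation of this inequality that was
    -- available for meets.
    have h0 : ∀ x : A, x * 0 ≤ 0 := fun x => by
      have := one_le_himp_iff.1 (hA _ (htop (.var 0)) fun _ => x)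
      rw [Fm.eval_neg, Fm.eval_neg, Fm.eval, Fm.eval, neg_one_eq] at this
      exact le_neg_iff_mul_le.1 this
    rcases h with h | h
    · have key : ∀ x y : A, _ := fun x y => le_zero_of_one_le_neg_mul_neg h0 (by
        have := h x y
        rwa [arrCirc_op (arrCirc.op x y), himp_neg_eq, himp_neg_eq] at this)
      refine IsBoethius.isWeaklyBoolean_mul ⟨fun x y => (key x y).1, fun x y => ?_⟩ h0
      rw [mul_comm]
      exact (key x y).2
    · have key : ∀ x y : A, _ := fun x y => le_zero_of_one_le_neg_mul_neg h0 (by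
        have := h x y
        rwa [arrCirc_op (arrCirc.op x (neg y)), himp_neg_eq, himp_neg_eq] at this)
      refine IsBoethius.isWeaklyBoolean_mul ⟨fun x y => ?_, fun x y => (key x y).2⟩ h0
      rw [mul_comm]
      exact (key x y).1

end Connexive

theorem mainTheorem6 (L : Connexive.Logic) (hL : L.IsSubstructural)
    (hIPL : L ≤ Connexive.IPL) :
    List.TFAE
      [ Connexive.Logic.IsConnexive.{u} L Connexive.arrMeet,
        Connexive.Logic.IsProtoConnexive.{u} L Connexive.arrMeet,
        L.ProvesBoethius₁ Connexive.arrMeet,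
        L.ProvesBoethius₂ Connexive.arrMeet,
        ∃ G : Connexive.Logic, G.IsGlivenkoLogic Connexive.CPL ∧ L.IsAxiomaticExtensionOf G ] ∧
    ((∀ φ : Connexive.Fm, L.IsTheorem (φ.imp Connexive.Fm.one.neg.neg)) →
      List.TFAE
        [ Connexive.Logic.IsConnexive.{u} L Connexive.arrCirc,
          Connexive.Logic.IsProtoConnexive.{u} L Connexive.arrCirc,
          L.ProvesBoethius₁ Connexive.arrCirc,
          L.ProvesBoethius₂ Connexive.arrCirc,
          ∃ G : Connexive.Logic, G.IsGlivenkoLogic Connexive.CPL ∧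
            L.IsAxiomaticExtensionOf G ]) :=
  ⟨Connexive.tfae_arrMeet hL hIPL, Connexive.tfae_arrCirc hL hIPL⟩
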